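/- Let $\mathcal M$ be a von Neumann algebra on a complex Hilbert space, and let $\mathcal M_*\subset\mathcal M^*$ be its predual, the Banach space of $\sigma$-weakly continuous (normal) functionals on $\mathcal M$. Let $G$ be a second countable locally compact (Hausdorff) group with left Haar measure $m$, $|A|=m(A)$. For $K\subset G$ and $\delta>0$, a compact set $F\subset G$ is called $(K,\delta)$-invariant if $|F\,\Delta\,KF|<\delta|F|$. Assume that $G$ is amenable, i.e. for every nonempty compact $K$ and every $\delta>0$ there is a $(K,\delta)$-invariant compact set. Let $(F_n)$ be a tempered Følner sequence, i.e. a sequence of compact subsets of $G$ such that for every nonempty compact $K$ and every $\delta>0$ the set $F_n$ is $(K,\delta)$-invariant for all sufficiently large $n$, and such that for some constant $C>0$ one has $\left|\bigcup_{k<n}F_k^{-1}F_n\right|<C|F_n|$ for all $n$. Let $g\mapsto\alpha_g$ be a homomorphism from $G$ to the group of $*$-automorphisms of $\mathcal M$ such that $g\mapsto\psi(\alpha_g(x))$ is (Haar) measurable for all $x\in\mathcal M$ and $\psi\in\mathcal M_*$, and let $\phi$ be a faithful normal state on $\mathcal M$ with $\phi\circ\alpha_g=\phi$ for all $g\in G$.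 Then: (a) The averages $$s_n(x)=\frac1{|F_n|}\int_{F_n}\alpha_g(x)\,dm(g)\qquad(x\in\mathcal M),$$ where the integral is taken in the weak* sense, that is $\psi(s_n(x))=\frac1{|F_n|}\int_{F_n}\psi(\alpha_g(x))\,dm(g)$ for all $\psi\in\mathcal M_*$, define bounded linear maps $s_n:\mathcal M\to\mathcal M$ which are unital, completely positive and normal (i.e. $\psi\circ s_n\in\mathcal M_*$ for all $\psi\in\mathcal M_*$). (b) There is exactly one normal norm-one projection $E$ from $\mathcal M$ onto the fixed-point algebra $\mathcal N=\{x\in\mathcal M:\alpha_g(x)=x\ \text{for all }g\in G\}$ with $\phi\circ E=\phi$, and for this $E$ $$\lim_{n\to\infty}\|\psi\circ s_n-\psi\circ E\|=0\qquad\text{for every }\psi\in\mathcal M_*.$$ -/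

import Mathlib

open MeasureTheory Filter Topology
open scoped Pointwise symmDiff InnerProductSpace ComplexOrder

namespace VNErgodic

section Group

variable {G : Type*} [Group G] [TopologicalSpace G] [MeasurableSpace G]

/-- `F` is `(K, δ)`-invariant: it is compact and `|F ∆ KF| < δ |F|`, where `|·|` is the
measure `m` (in the applications, a left Haar measure). -/
def IsInvariantSet (m : Measure G) (K : Set G) (δ : ℝ) (F : Set G) : Prop :=
  IsCompact F ∧ m (F ∆ (K * F)) < ENNReal.ofReal δ * m F

/-- Amenability of a locally compact group with left Haar measure `m`: for every nonempty
compact `K` and every `δ > 0` there is a `(K, δ)`-invariant compact set. -/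
def IsAmenable (m : Measure G) : Prop :=
  ∀ K : Set G, IsCompact K → K.Nonempty → ∀ δ : ℝ, 0 < δ → ∃ F : Set G, IsInvariantSet m K δ F

/-- A Følner sequence: a sequence of compact sets which, for every nonempty compact `K` and every
`δ > 0`, are `(K, δ)`-invariant from some index on. -/
structure IsFolnerSeq (m : Measure G) (F : ℕ → Set G) : Prop where
  isCompact : ∀ n, IsCompact (F n)
  eventually_invariant : ∀ K : Set G, IsCompact K → K.Nonempty → ∀ δ : ℝ, 0 < δ →
    ∃ N : ℕ, ∀ n, N ≤ n → IsInvariantSet m K δ (F n)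

/-- Shulman's temperedness: `|⋃_{k < n} F_k⁻¹ F_n| < C |F_n|` for all `n`, for some `C > 0`. -/
def IsTempered (m : Measure G) (F : ℕ → Set G) : Prop :=
  ∃ C : ℝ, 0 < C ∧ ∀ n, m (⋃ k, ⋃ (_ : k < n), (F k)⁻¹ * F n) < ENNReal.ofReal C * m (F n)

end Group

section Algebra

variable {H : Type*} [NormedAddCommGroup H] [InnerProductSpace ℂ H] [CompleteSpace H]

/-- The elements of a von Neumann algebra `M` acting on `H`, as a type. -/
abbrev Elt (M : VonNeumannAlgebra H) : Type _ := M.toStarSubalgebra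

/-- The functional `x ↦ ⟪ξ, x η⟫` on `M`. -/
noncomputable def vectorFunctional (M : VonNeumannAlgebra H) (ξ η : H) : StrongDual ℂ (Elt M) :=
  LinearMap.mkContinuous
    { toFun := fun x => ⟪ξ, (x : H →L[ℂ] H) η⟫_ℂ
      map_add' := fun x y => by simp
      map_smul' := fun c x => by simp }
    (‖ξ‖ * ‖η‖)
    (fun x => by
      calc ‖⟪ξ, (x : H →L[ℂ] H) η⟫_ℂ‖ ≤ ‖ξ‖ * ‖(x : H →L[ℂ] H) η‖ := norm_inner_le_norm _ _
        _ ≤ ‖ξ‖ * (‖(x : H →L[ℂ] H)‖ * ‖η‖) := by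
            gcongr
            exact (x : H →L[ℂ] H).le_opNorm η
        _ = ‖ξ‖ * ‖η‖ * ‖x‖ := by
            rw [show ‖x‖ = ‖(x : H →L[ℂ] H)‖ from rfl]
            ring)

/-- The predual `M_*` of `M`, as a subspace of the Banach dual `M^*`: the norm closure of the
linear span of the functionals `x ↦ ⟪ξ, x η⟫`, `ξ η : H`. Its elements are exactly the
`σ`-weakly continuous functionals, also called the normal functionals, on `M`. -/
noncomputable def predual (M : VonNeumannAlgebra H) : Submodule ℂ (StrongDual ℂ (Elt M)) :=
  (Submodule.span ℂ {ψ | ∃ ξ η : H, ψ = vectorFunctional M ξ η}).topologicalClosure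

/-- A bounded linear map on `M` is normal (`σ`-weakly continuous) if composition with it maps
`M_*` to `M_*`. -/
def IsNormalMap (M : VonNeumannAlgebra H) (T : Elt M →L[ℂ] Elt M) : Prop :=
  ∀ ψ ∈ predual M, ψ.comp T ∈ predual M

/-- `φ` is a faithful normal state on `M`. -/
structure IsFaithfulNormalState (M : VonNeumannAlgebra H) (φ : StrongDual ℂ (Elt M)) : Prop where
  normal : φ ∈ predual M
  nonneg : ∀ x : Elt M, 0 ≤ φ (star x * x)
  map_one : φ 1 = 1
  faithful : ∀ x : Elt M, φ (star x * x) = 0 → x = 0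

/-- Complete positivity: for every `k`, applying `T` to the entries of a positive element `B* B`
of the matrix algebra `M_k(M)` gives a positive operator on `H ⊕ ⋯ ⊕ H` (`k` summands). -/
def IsCompletelyPositive (M : VonNeumannAlgebra H) (T : Elt M →L[ℂ] Elt M) : Prop :=
  ∀ (k : ℕ) (B : Matrix (Fin k) (Fin k) (Elt M)) (ξ : Fin k → H),
    0 ≤ ∑ i, ∑ j, ⟪ξ i, ((T ((B.conjTranspose * B) i j) : Elt M) : H →L[ℂ] H) (ξ j)⟫_ℂ

variable {G : Type*} [Group G]

/-- The fixed-point algebra `{x ∈ M : α_g(x) = x for all g}`. -/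
def fixedPoints (M : VonNeumannAlgebra H) (α : G →* (Elt M ≃⋆ₐ[ℂ] Elt M)) :
    StarSubalgebra ℂ (Elt M) where
  carrier := {x | ∀ g, α g x = x}
  mul_mem' := fun {a b} ha hb g => by rw [map_mul, ha g, hb g]
  add_mem' := fun {a b} ha hb g => by rw [map_add, ha g, hb g]
  algebraMap_mem' := fun c g => by
    rw [Algebra.algebraMap_eq_smul_one, map_smul, map_one]
  star_mem' := fun {a} ha g => by rw [map_star, ha g]

/-- `E` is a normal norm-one projection from `M` onto the subalgebra `N`. -/
structure IsNormalNormOneProjection (M : VonNeumannAlgebra H) (N : StarSubalgebra ℂ (Elt M))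
    (E : Elt M →L[ℂ] Elt M) : Prop where
  normal : IsNormalMap M E
  norm_eq_one : ‖E‖ = 1
  map_mem : ∀ x, E x ∈ N
  map_eq_self : ∀ x ∈ N, E x = x

/-- `T(x) = |F|⁻¹ ∫_F α_g(x) dm(g)` for all `x ∈ M`, as a weak* integral: it holds after
evaluation at every `ψ ∈ M_*`. As `M_*` separates the points of `M`, this determines `T`. -/
def IsAverage (M : VonNeumannAlgebra H) (α : G →* (Elt M ≃⋆ₐ[ℂ] Elt M)) [MeasurableSpace G]
    (m : Measure G) (F : Set G) (T : Elt M →L[ℂ] Elt M) : Prop :=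
  ∀ x : Elt M, ∀ ψ ∈ predual M,
    IntegrableOn (fun g => ψ (α g x)) F m ∧
      ψ (T x) = (m.real F)⁻¹ • ∫ g in F, ψ (α g x) ∂m

end Algebra

end VNErgodic

/-! Since `M` is the dual of `M_*`, weak* averages exist, and convergence of `ψ ∘ s_n` in norm is
strong convergence of contractions on `M_*`; it suffices to test a dense set of `ψ`. As `φ` is
faithful, the functionals `φ(a* ·)` separate the points of `M`, hence are dense in `M_*`. Invariance
of `φ` gives `φ(a* s_n(x)) = φ(S_n(a)* x)`, where `S_n` averages `α_{g⁻¹}` over `F_n`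
(`stateFunctional_comp_average`), and `‖φ(a* ·)‖` is at most the seminorm `φ(a* a)^{1/2}`. So
everything reduces to a mean ergodic theorem: `S_n(a)` is Cauchy in that seminorm
(`exists_forall_stateNorm_sub_le`). It is proved inside `M`, with nearly minimal elements in place
of a Hilbert space completion.

The limit on `M_*` dualizes to a normal contraction `E` (`exists_normal_limit`). It fixes fixed
points because each `s_n` does, and its values are fixed because `α_k s_n - s_n` tends to zero by
the Følner property.

For uniqueness, a norm-one projection onto the fixed points is unital, so it preserves
self-adjointness. By Kadison's inequality it contracts the seminorm of `φ` on self-adjoint elements.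
Its kernel is then orthogonal to its range for `φ`, which determines it because `φ` is faithful. -/

namespace VNErgodic

/-! ### Separation and density in normed spaces -/

section NormedSpace

variable {V : Type*} [NormedAddCommGroup V] [NormedSpace ℂ V]

theorem exists_dual_ne_zero_of_notMem_closure {p : Submodule ℂ V} {v : V}
    (hv : v ∉ p.topologicalClosure) : ∃ L : StrongDual ℂ V, L v ≠ 0 ∧ ∀ w ∈ p, L w = 0 := by
  have : IsClosed (p.topologicalClosure : Set V) := Submodule.isClosed_topologicalClosure _
  have hne : p.topologicalClosure.mkQ v ≠ 0 := by
    simpa [Submodule.Quotient.mk_eq_zero] using hv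
  obtain ⟨f, hf⟩ := SeparatingDual.exists_ne_zero (R := ℂ) hne
  refine ⟨f.comp p.topologicalClosure.mkQL, hf, fun w hw => ?_⟩
  have : p.topologicalClosure.mkQ w = 0 := by
    simpa [Submodule.Quotient.mk_eq_zero] using! Submodule.le_topologicalClosure p hw
  simpa using (congrArg f this).trans (map_zero f)

theorem eq_of_eqOn_topologicalClosure_span {S : Set V} {p : Submodule ℂ V}
    (hp : p = (Submodule.span ℂ S).topologicalClosure) (L : p →ₗ[ℂ] ℂ) (C : ℝ)
    (hL : ∀ v, ‖L v‖ ≤ C * ‖(v : V)‖) (f : StrongDual ℂ V)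
    (h : ∀ v : p, (v : V) ∈ S → f v = L v) (v : p) : f v = L v := by
  have hLc : Continuous L := (L.mkContinuous C hL).continuous
  let q : Submodule ℂ p := LinearMap.ker (f.toLinearMap.comp p.subtype - L)
  have hqc : IsClosed (q : Set p) := by
    have : (q : Set p) = {w : p | f w = L w} := by
      ext w; simp [q, sub_eq_zero]
    rw [this]
    exact isClosed_eq (f.continuous.comp continuous_subtype_val) hLc
  have hpc : IsClosed (p : Set V) := hp ▸ Submodule.isClosed_topologicalClosure _
  have hS : ∀ w ∈ S, w ∈ p := fun w hw =>
    hp ▸ Submodule.le_topologicalClosure _ (Submodule.subset_span hw)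
  have hle : (Submodule.span ℂ S).topologicalClosure ≤ q.map p.subtype := by
    refine Submodule.topologicalClosure_minimal _ (Submodule.span_le.2 fun w hw =>
      ⟨⟨w, hS w hw⟩, ?_, rfl⟩) ?_
    · simpa [q, sub_eq_zero] using h ⟨w, hS w hw⟩ hw
    · rw [Submodule.map_coe]
      exact hpc.isClosedEmbedding_subtypeVal.isClosedMap _ hqc
  obtain ⟨w, hw, hwv⟩ := hle (hp.le v.2)
  obtain rfl : w = v := Subtype.ext hwv
  simpa [q, sub_eq_zero] using hw

end NormedSpace

/-! ### `M` as the dual of `M_*` -/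

section Duality

variable {H : Type*} [NormedAddCommGroup H] [InnerProductSpace ℂ H] [CompleteSpace H]
  {M : VonNeumannAlgebra H}

theorem isClosed_toStarSubalgebra (M : VonNeumannAlgebra H) :
    IsClosed (M.toStarSubalgebra : Set (H →L[ℂ] H)) := by
  rw [VonNeumannAlgebra.coe_toStarSubalgebra, ← M.centralizer_centralizer]
  exact Set.isClosed_centralizer _

@[simp]
theorem vectorFunctional_apply (ξ η : H) (x : Elt M) :
    vectorFunctional M ξ η x = ⟪ξ, (x : H →L[ℂ] H) η⟫_ℂ := rfl

theorem norm_vectorFunctional_le (ξ η : H) : ‖vectorFunctional M ξ η‖ ≤ ‖ξ‖ * ‖η‖ :=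
  LinearMap.mkContinuous_norm_le _ (by positivity) _

theorem vectorFunctional_mem_predual (ξ η : H) : vectorFunctional M ξ η ∈ predual M :=
  Submodule.le_topologicalClosure _ (Submodule.subset_span ⟨ξ, η, rfl⟩)

theorem isClosed_predual : IsClosed (predual M : Set (StrongDual ℂ (Elt M))) :=
  Submodule.isClosed_topologicalClosure _

/-- A closed subspace of `M^*` contains `M_*` as soon as it contains the vector functionals. -/
theorem predual_le {p : Submodule ℂ (StrongDual ℂ (Elt M))}
    (hp : IsClosed (p : Set (StrongDual ℂ (Elt M))))
    (h : ∀ ξ η, vectorFunctional M ξ η ∈ p) : predual M ≤ p :=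
  Submodule.topologicalClosure_minimal _
    (Submodule.span_le.2 (by rintro _ ⟨ξ, η, rfl⟩; exact h ξ η)) hp

/-- Every bounded functional on `M_*` is the evaluation at an element of `M`. -/
theorem exists_forall_predual_apply_eq (L : predual M →ₗ[ℂ] ℂ) (C : ℝ)
    (hL : ∀ ψ, ‖L ψ‖ ≤ C * ‖(ψ : StrongDual ℂ (Elt M))‖) :
    ∃ x : Elt M, ∀ ψ : predual M, (ψ : StrongDual ℂ (Elt M)) x = L ψ := by
  have hC : ∀ ξ η : H, ‖L ⟨_, vectorFunctional_mem_predual (M := M) ξ η⟩‖ ≤ |C| * ‖ξ‖ * ‖η‖ := by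
    intro ξ η
    refine (hL _).trans ?_
    rw [mul_assoc]
    exact mul_le_mul (le_abs_self C) (norm_vectorFunctional_le ξ η) (norm_nonneg _) (abs_nonneg C)
  -- The bounded sesquilinear form `(ξ, η) ↦ L(ω_{ξ,η})` on vector functionals is represented by an
  -- operator `S`.
  let B : H →L⋆[ℂ] H →L[ℂ] ℂ := LinearMap.mkContinuous₂
    (LinearMap.mk₂'ₛₗ (starRingEnd ℂ) (RingHom.id ℂ)
      (fun ξ η => L ⟨_, vectorFunctional_mem_predual (M := M) ξ η⟩)
      (fun ξ ξ' η => by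
        rw [← map_add]; congr 1; ext x; simp)
      (fun c ξ η => by
        rw [smul_eq_mul, ← smul_eq_mul, ← map_smul]; congr 1; ext x; simp [mul_comm])
      (fun ξ η η' => by
        rw [← map_add]; congr 1; ext x; simp)
      (fun c ξ η => by
        rw [RingHom.id_apply, ← map_smul]; congr 1; ext x; simp))
    |C| hC
  have hB : ∀ ξ η, B ξ η = L ⟨_, vectorFunctional_mem_predual (M := M) ξ η⟩ := fun _ _ => rfl
  let S : H →L[ℂ] H := (InnerProductSpace.continuousLinearMapOfBilin B).adjoint
  have hS : ∀ ξ η, ⟪ξ, S η⟫_ℂ = B ξ η := fun ξ η => by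
    rw [ContinuousLinearMap.adjoint_inner_right,
      InnerProductSpace.continuousLinearMapOfBilin_apply]
  -- Bicommutant theorem: for `y` in the commutant, `ω_{y*ξ,η}` and `ω_{ξ,yη}` agree on `M`, so `S`
  -- commutes with `y`.
  have hSM : S ∈ M := by
    rw [← M.commutant_commutant, VonNeumannAlgebra.mem_commutant_iff]
    intro y hy
    rw [VonNeumannAlgebra.mem_commutant_iff] at hy
    ext η
    refine ext_inner_left ℂ fun ξ => ?_
    simp only [mul_apply_eq_comp]
    rw [← ContinuousLinearMap.adjoint_inner_left, hS, hS, hB, hB]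
    congr 2
    ext x
    simp only [vectorFunctional_apply, ContinuousLinearMap.adjoint_inner_left]
    have := congrArg (fun T : H →L[ℂ] H => T η) (hy x x.2)
    simp only [mul_apply_eq_comp] at this
    rw [this]
  refine ⟨⟨S, hSM⟩, fun ψ => ?_⟩
  exact eq_of_eqOn_topologicalClosure_span rfl L C hL
    (ContinuousLinearMap.apply ℂ ℂ (⟨S, hSM⟩ : Elt M))
    (by rintro ⟨_, _⟩ ⟨ξ, η, rfl⟩; exact hS ξ η) ψ

theorem norm_le_of_forall_predual {x : Elt M} {C : ℝ} (hC : 0 ≤ C)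
    (h : ∀ ψ ∈ predual M, ‖ψ x‖ ≤ C * ‖ψ‖) : ‖x‖ ≤ C := by
  refine ContinuousLinearMap.opNorm_le_bound (x : H →L[ℂ] H) hC fun η => ?_
  -- Testing on `ω_{xη,η}` gives `‖xη‖² ≤ C ‖xη‖ ‖η‖`.
  have h1 := h _ (vectorFunctional_mem_predual ((x : H →L[ℂ] H) η) η)
  rw [vectorFunctional_apply, inner_self_eq_norm_sq_to_K, norm_pow, RCLike.norm_ofReal,
    abs_norm] at h1
  have h2 := h1.trans (mul_le_mul_of_nonneg_left (norm_vectorFunctional_le _ _) hC)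
  rcases (norm_nonneg ((x : H →L[ℂ] H) η)).eq_or_lt with h0 | h0
  · rw [← h0]; positivity
  · exact le_of_mul_le_mul_left (by linarith) h0

theorem eq_of_forall_predual {x y : Elt M} (h : ∀ ψ ∈ predual M, ψ x = ψ y) : x = y := by
  rw [← sub_eq_zero, ← norm_le_zero_iff]
  exact norm_le_of_forall_predual le_rfl fun ψ hψ => by simp [h ψ hψ]

/-- A subspace of `M^*` separating the points of `M` is dense in `M_*`. -/
theorem predual_le_topologicalClosure {p : Submodule ℂ (StrongDual ℂ (Elt M))}
    (hp : p ≤ predual M) (h : ∀ x : Elt M, (∀ ψ ∈ p, ψ x = 0) → x = 0) :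
    predual M ≤ p.topologicalClosure := by
  intro ψ hψ
  by_contra hn
  obtain ⟨L, hL, hLp⟩ := exists_dual_ne_zero_of_notMem_closure hn
  obtain ⟨x, hx⟩ := exists_forall_predual_apply_eq (L.toLinearMap.comp (predual M).subtype) ‖L‖
    (fun ψ => L.le_opNorm _)
  have hx0 : x = 0 := h x fun ω hω => by
    exact (hx ⟨ω, hp hω⟩).trans (hLp ω hω)
  have := hx ⟨ψ, hψ⟩
  rw [hx0, map_zero] at this
  exact hL this.symm

end Duality

/-! ### Weak* integrals -/

section Average

variable {H : Type*} [NormedAddCommGroup H] [InnerProductSpace ℂ H] [CompleteSpace H]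
  {M : VonNeumannAlgebra H}

/-- Linear maps of `M` defined pointwise through their action on normal functionals. -/
theorem exists_clm_of_forall_predual (L : Elt M → StrongDual ℂ (Elt M) → ℂ)
    (hadd : ∀ x y, ∀ ψ ∈ predual M, L (x + y) ψ = L x ψ + L y ψ)
    (hsmul : ∀ (c : ℂ) x, ∀ ψ ∈ predual M, L (c • x) ψ = c * L x ψ)
    (hadd' : ∀ x, ∀ ψ ∈ predual M, ∀ ψ' ∈ predual M, L x (ψ + ψ') = L x ψ + L x ψ')
    (hsmul' : ∀ (c : ℂ) x, ∀ ψ ∈ predual M, L x (c • ψ) = c * L x ψ)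
    (hb : ∀ x, ∀ ψ ∈ predual M, ‖L x ψ‖ ≤ ‖x‖ * ‖ψ‖) :
    ∃ T : Elt M →L[ℂ] Elt M, ‖T‖ ≤ 1 ∧ ∀ x, ∀ ψ ∈ predual M, ψ (T x) = L x ψ := by
  have hex : ∀ x : Elt M, ∃ y : Elt M, ∀ ψ ∈ predual M, ψ y = L x ψ := fun x => by
    obtain ⟨y, hy⟩ := exists_forall_predual_apply_eq (M := M)
      { toFun := fun ψ => L x ψ
        map_add' := fun ψ ψ' => hadd' x ψ ψ.2 ψ' ψ'.2
        map_smul' := fun c ψ => hsmul' c x ψ ψ.2 } ‖x‖ (fun ψ => hb x ψ ψ.2)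
    exact ⟨y, fun ψ hψ => hy ⟨ψ, hψ⟩⟩
  choose T hT using hex
  let T₀ : Elt M →ₗ[ℂ] Elt M :=
    { toFun := T
      map_add' := fun x y => eq_of_forall_predual fun ψ hψ => by
        rw [map_add, hT _ _ hψ, hT _ _ hψ, hT _ _ hψ, hadd _ _ _ hψ]
      map_smul' := fun c x => eq_of_forall_predual fun ψ hψ => by
        rw [map_smul, hT _ _ hψ, hT _ _ hψ, hsmul _ _ _ hψ]; rfl }
  have hT₀ : ∀ x, ‖T₀ x‖ ≤ 1 * ‖x‖ := fun x => by
    rw [one_mul]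
    exact norm_le_of_forall_predual (norm_nonneg _) fun ψ hψ => by
      change ‖ψ (T x)‖ ≤ _
      rw [hT _ _ hψ]; exact hb x ψ hψ
  exact ⟨T₀.mkContinuous 1 hT₀, LinearMap.mkContinuous_norm_le _ zero_le_one _, hT⟩

/-- The `μ`-average of a weak* measurable family of contractions of `M`, as a weak* integral. -/
theorem exists_average {Ω : Type*} [MeasurableSpace Ω] (μ : Measure Ω) [IsFiniteMeasure μ]
    (β : Ω → Elt M →L[ℂ] Elt M) (hβ : ∀ w, ‖β w‖ ≤ 1)
    (hm : ∀ x : Elt M, ∀ ψ ∈ predual M, AEMeasurable (fun w => ψ (β w x)) μ) :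
    ∃ T : Elt M →L[ℂ] Elt M, ‖T‖ ≤ 1 ∧ ∀ x : Elt M, ∀ ψ ∈ predual M,
      Integrable (fun w => ψ (β w x)) μ ∧
        ψ (T x) = (μ.real Set.univ)⁻¹ • ∫ w, ψ (β w x) ∂μ := by
  have hb : ∀ x w (ψ : StrongDual ℂ (Elt M)), ‖ψ (β w x)‖ ≤ ‖x‖ * ‖ψ‖ := fun x w ψ => by
    have h1 := (β w).le_of_opNorm_le (hβ w) x
    rw [one_mul] at h1
    rw [mul_comm]
    exact (ψ.le_opNorm _).trans (mul_le_mul_of_nonneg_left h1 (norm_nonneg _))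
  have hint : ∀ x : Elt M, ∀ ψ ∈ predual M, Integrable (fun w => ψ (β w x)) μ := fun x ψ hψ =>
    Integrable.of_bound (hm x ψ hψ).aestronglyMeasurable (‖x‖ * ‖ψ‖)
      (ae_of_all _ fun w => hb x w ψ)
  obtain ⟨T, hT, hTL⟩ := exists_clm_of_forall_predual (M := M)
    (fun x ψ => (μ.real Set.univ)⁻¹ • ∫ w, ψ (β w x) ∂μ)
    (fun x y ψ hψ => by
      simp only [map_add]
      rw [integral_add (hint x ψ hψ) (hint y ψ hψ), smul_add])
    (fun c x ψ hψ => by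
      simp only [map_smul, smul_eq_mul, integral_const_mul, Complex.real_smul]
      ring)
    (fun x ψ hψ ψ' hψ' => by
      simp only [add_apply]
      rw [integral_add (hint x ψ hψ) (hint x ψ' hψ'), smul_add])
    (fun c x ψ hψ => by
      simp only [smul_apply, smul_eq_mul, integral_const_mul,
        Complex.real_smul]
      ring)
    (fun x ψ _ => by
      have h1 := norm_integral_le_of_norm_le_const (μ := μ) (ae_of_all _ fun w => hb x w ψ)
      rw [norm_smul, norm_inv, Real.norm_of_nonneg measureReal_nonneg]
      rcases (measureReal_nonneg (μ := μ) (s := Set.univ)).eq_or_lt with h0 | h0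
      -- For the zero measure the convention `0⁻¹ = 0` makes the average zero.
      · rw [← h0, inv_zero, zero_mul]; positivity
      · rw [inv_mul_le_iff₀ h0]; linarith)
  exact ⟨T, hT, fun x ψ hψ => ⟨hint x ψ hψ, hTL x ψ hψ⟩⟩

end Average

/-! ### The Hilbert seminorm of a positive functional -/

section PositiveFunctional

variable {A : Type*} [NormedRing A] [StarRing A] [NormedAlgebra ℂ A] [StarModule ℂ A]
  {φ : StrongDual ℂ A}

/-- The Hilbert seminorm `φ(x* x)^{1/2}` of a positive functional `φ`. -/
noncomputable def stateNorm (φ : StrongDual ℂ A) (x : A) : ℝ := √ (φ (star x * x)).re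

omit [StarModule ℂ A] in
theorem stateNorm_nonneg (x : A) : 0 ≤ stateNorm φ x := Real.sqrt_nonneg _

omit [StarModule ℂ A] in
theorem stateNorm_sq (hφ : ∀ x, 0 ≤ φ (star x * x)) (x : A) :
    stateNorm φ x ^ 2 = (φ (star x * x)).re :=
  Real.sq_sqrt (Complex.nonneg_iff.1 (hφ x)).1

omit [StarModule ℂ A] in
theorem apply_star_mul_self (hφ : ∀ x, 0 ≤ φ (star x * x)) (x : A) :
    φ (star x * x) = (stateNorm φ x ^ 2 : ℝ) := by
  rw [stateNorm_sq hφ]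
  exact Complex.ext rfl (Complex.nonneg_iff.1 (hφ x)).2.symm

/-- Polarization: `φ` is real on the squares of `x + y` and `x + iy`, which fixes the imaginary and
real parts respectively. -/
theorem apply_star_mul_comm (hφ : ∀ x, 0 ≤ φ (star x * x)) (x y : A) :
    starRingEnd ℂ (φ (star x * y)) = φ (star y * x) := by
  have h1 := (Complex.nonneg_iff.1 (hφ (x + y))).2
  have h2 := (Complex.nonneg_iff.1 (hφ (x + Complex.I • y))).2
  have hx := (Complex.nonneg_iff.1 (hφ x)).2
  have hy := (Complex.nonneg_iff.1 (hφ y)).2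
  simp only [star_add, star_smul, add_mul, mul_add, smul_mul_assoc, mul_smul_comm, map_add,
    map_smul, Complex.add_im, smul_eq_mul, Complex.star_def, Complex.conj_I, Complex.mul_im,
    Complex.neg_re, Complex.neg_im, Complex.I_re, Complex.I_im, Complex.mul_re] at h1 h2
  apply Complex.ext
  · rw [Complex.conj_re]; linarith
  · rw [Complex.conj_im]; linarith

theorem apply_star (hφ : ∀ x, 0 ≤ φ (star x * x)) (x : A) :
    φ (star x) = starRingEnd ℂ (φ x) := by
  have := apply_star_mul_comm hφ 1 x
  simpa using this.symm

theorem norm_apply_star_mul_le (hφ : ∀ x, 0 ≤ φ (star x * x)) (x y : A) :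
    ‖φ (star x * y)‖ ≤ stateNorm φ x * stateNorm φ y := by
  let c : PreInnerProductSpace.Core ℂ A :=
    { inner := fun x y => φ (star x * y)
      conj_inner_symm := fun x y => apply_star_mul_comm hφ y x
      re_inner_nonneg := fun x => (Complex.nonneg_iff.1 (hφ x)).1
      add_left := fun x y z => by simp [add_mul]
      smul_left := fun x y r => by simp }
  have h := @InnerProductSpace.Core.inner_mul_inner_self_le ℂ A _ _ _ c x y
  change ‖φ (star x * y)‖ * ‖φ (star y * x)‖ ≤ (φ (star x * x)).re * (φ (star y * y)).re at h
  rw [← apply_star_mul_comm hφ x y, RCLike.norm_conj, ← stateNorm_sq hφ, ← stateNorm_sq hφ,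
    ← sq, ← mul_pow] at h
  exact le_of_sq_le_sq h (mul_nonneg (stateNorm_nonneg _) (stateNorm_nonneg _))

theorem stateNorm_add_sq (hφ : ∀ x, 0 ≤ φ (star x * x)) (x y : A) :
    stateNorm φ (x + y) ^ 2 =
      stateNorm φ x ^ 2 + 2 * (φ (star x * y)).re + stateNorm φ y ^ 2 := by
  have := congrArg Complex.re (apply_star_mul_comm hφ x y)
  simp only [Complex.conj_re] at this
  simp only [stateNorm_sq hφ, star_add, add_mul, mul_add, map_add, Complex.add_re, ← this]
  ring

omit [StarModule ℂ A] in
theorem stateNorm_neg (x : A) : stateNorm φ (-x) = stateNorm φ x := by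
  simp [stateNorm]

theorem stateNorm_add_le (hφ : ∀ x, 0 ≤ φ (star x * x)) (x y : A) :
    stateNorm φ (x + y) ≤ stateNorm φ x + stateNorm φ y := by
  refine le_of_sq_le_sq ?_ (add_nonneg (stateNorm_nonneg _) (stateNorm_nonneg _))
  rw [stateNorm_add_sq hφ]
  have := (Complex.re_le_norm _).trans (norm_apply_star_mul_le hφ x y)
  nlinarith

theorem stateNorm_sub_le (hφ : ∀ x, 0 ≤ φ (star x * x)) (x y z : A) :
    stateNorm φ (x - z) ≤ stateNorm φ (x - y) + stateNorm φ (y - z) := by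
  have := stateNorm_add_le hφ (x - y) (y - z)
  rwa [sub_add_sub_cancel] at this

omit [StarModule ℂ A] in
theorem stateNorm_sub_comm (x y : A) : stateNorm φ (x - y) = stateNorm φ (y - x) := by
  rw [← stateNorm_neg, neg_sub]

theorem stateNorm_smul (c : ℂ) (x : A) : stateNorm φ (c • x) = ‖c‖ * stateNorm φ x := by
  have h : starRingEnd ℂ c * (c * φ (star x * x)) = ((‖c‖ ^ 2 : ℝ) : ℂ) * φ (star x * x) := by
    rw [← mul_assoc, mul_comm _ c, Complex.mul_conj, Complex.normSq_eq_norm_sq]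
  rw [stateNorm, stateNorm, star_smul, smul_mul_assoc, mul_smul_comm, map_smul, map_smul,
    smul_eq_mul, smul_eq_mul, Complex.star_def, h, Complex.re_ofReal_mul,
    Real.sqrt_mul (by positivity), Real.sqrt_sq (norm_nonneg _)]

theorem stateNorm_parallelogram (hφ : ∀ x, 0 ≤ φ (star x * x)) (x y : A) :
    stateNorm φ (x - y) ^ 2 + stateNorm φ (x + y) ^ 2 =
      2 * (stateNorm φ x ^ 2 + stateNorm φ y ^ 2) := by
  rw [sub_eq_add_neg, stateNorm_add_sq hφ, stateNorm_add_sq hφ, stateNorm_neg, mul_neg, map_neg,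
    Complex.neg_re]
  ring

end PositiveFunctional

/-! ### Norm estimates in C*-algebras -/

section CStar

variable {A : Type*} [NormedRing A] [StarRing A] [NormedAlgebra ℂ A] [StarModule ℂ A]
  [CStarRing A] [CompleteSpace A]

/-- `‖x‖² - x* x` is positive. -/
theorem exists_star_mul_self_add_eq (x : A) :
    ∃ y : A, star x * x + star y * y = ((‖x‖ ^ 2 : ℝ) : ℂ) • 1 := by
  let _ : CStarAlgebra A := { }
  let _ : PartialOrder A := CStarAlgebra.spectralOrder A
  let _ : StarOrderedRing A := CStarAlgebra.spectralOrderedRing A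
  have h : 0 ≤ algebraMap ℝ A ‖star x * x‖ - star x * x :=
    sub_nonneg.2 (IsSelfAdjoint.star_mul_self x).le_algebraMap_norm_self
  obtain ⟨y, hy⟩ := CStarAlgebra.nonneg_iff_eq_star_mul_self.1 h
  refine ⟨y, ?_⟩
  rw [← hy, add_sub_cancel, CStarRing.norm_star_mul_self, ← sq, Algebra.algebraMap_eq_smul_one]
  rfl

theorem norm_starAlgEquiv_apply (α : A ≃⋆ₐ[ℂ] A) (x : A) : ‖α x‖ = ‖x‖ := by
  let _ : CStarAlgebra A := { }
  exact StarAlgEquiv.norm_map α x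

variable {φ : StrongDual ℂ A}

theorem stateNorm_le_norm (hφ : ∀ x, 0 ≤ φ (star x * x)) (h1 : φ 1 = 1) (x : A) :
    stateNorm φ x ≤ ‖x‖ := by
  obtain ⟨y, hy⟩ := exists_star_mul_self_add_eq x
  have h := congrArg (fun z => (φ z).re) hy
  simp only [map_add, map_smul, h1, smul_eq_mul, mul_one, Complex.add_re, Complex.ofReal_re,
    ← stateNorm_sq hφ] at h
  exact le_of_sq_le_sq (by nlinarith [sq_nonneg (stateNorm φ y)]) (norm_nonneg x)

end CStar

/-! ### Kadison's inequality and orthogonality of projections -/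

section Contraction

variable {A : Type*} [NormedRing A] [StarRing A] [NormedAlgebra ℂ A] [StarModule ℂ A]
  [CStarRing A] [CompleteSpace A] {φ : StrongDual ℂ A}

/-- Kadison's inequality `T(a)² ≤ T(a²)` for a unital contraction `T` and a self-adjoint `a`,
integrated against an invariant state. -/
theorem stateNorm_map_le (hφ : ∀ x, 0 ≤ φ (star x * x)) (h1 : φ 1 = 1) {T : A →L[ℂ] A}
    (hT : ‖T‖ ≤ 1) (hT1 : T 1 = 1) (hφT : ∀ x, φ (T x) = φ x) {a : A} (ha : star a = a) :
    stateNorm φ (T a) ≤ stateNorm φ a := by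
  have hne : Nontrivial A := ⟨⟨1, 0, fun h => by simp [h] at h1⟩⟩
  have hφa : (φ a).im = 0 := by
    have := congrArg Complex.im (apply_star hφ a)
    rw [ha, Complex.conj_im] at this
    linarith
  have hφaa : (φ (a * a)).re = stateNorm φ a ^ 2 := by rw [stateNorm_sq hφ, ha]
  have key : ∀ t : ℝ, 0 < t →
      stateNorm φ (T a + (Complex.I * (t / 2)) • T (a * a)) ^ 2 ≤
        stateNorm φ a ^ 2 + t ^ 2 / 4 * ‖a‖ ^ 4 := by
    intro t ht
    -- The second-order Taylor polynomial of `exp(ita)`: its deviation from unitarity is only of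
    -- order `t⁴`. Expanding the seminorm of `T u` and dividing by `t²` then leaves the desired
    -- inequality as `t → 0`.
    let u : A := 1 + (Complex.I * t) • (a + (Complex.I * (t / 2)) • (a * a))
    have hu : star u * u = 1 + ((t ^ 4 / 4 : ℝ) : ℂ) • (a * a * (a * a)) := by
      have hs : star (Complex.I * t : ℂ) = -(Complex.I * t) := by simp
      have hs' : star (Complex.I * t / 2 : ℂ) = -(Complex.I * t) / 2 := by simp
      have hI : Complex.I ^ 4 = 1 := Complex.I_pow_four
      have ht4 : ((t ^ 4 / 4 : ℝ) : ℂ) = (Complex.I * t) ^ 4 / 4 := by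
        rw [mul_pow, hI]; push_cast; ring
      have ht2 : Complex.I * ((t : ℂ) / 2) = (Complex.I * t) / 2 := by ring
      simp only [u, star_add, star_one, star_smul, star_mul, ha, hs, hs', ht4, ht2]
      generalize Complex.I * (t : ℂ) = s
      simp only [add_mul, mul_add, one_mul, mul_one, smul_add, smul_smul, smul_mul_assoc,
        mul_smul_comm, mul_assoc]
      match_scalars <;> ring
    have hun : ‖u‖ ^ 2 ≤ 1 + t ^ 4 / 4 * ‖a‖ ^ 4 := by
      rw [sq, ← CStarRing.norm_star_mul_self, hu]
      refine (norm_add_le _ _).trans ?_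
      rw [CStarRing.norm_one, norm_smul, Complex.norm_real, Real.norm_of_nonneg (by positivity)]
      gcongr
      calc ‖a * a * (a * a)‖ ≤ (‖a‖ * ‖a‖) * (‖a‖ * ‖a‖) :=
            (norm_mul_le _ _).trans (mul_le_mul (norm_mul_le _ _) (norm_mul_le _ _)
              (norm_nonneg _) (by positivity))
        _ = ‖a‖ ^ 4 := by ring
    have hTu : T u = 1 + (Complex.I * t) • (T a + (Complex.I * (t / 2)) • T (a * a)) := by
      simp only [u, map_add, map_smul, hT1]
    have h2 : stateNorm φ (T u) ^ 2 ≤ 1 + t ^ 4 / 4 * ‖a‖ ^ 4 := by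
      refine le_trans ?_ hun
      gcongr
      · exact stateNorm_nonneg _
      · exact (stateNorm_le_norm hφ h1 _).trans (by simpa using T.le_of_opNorm_le hT u)
    have h3 : stateNorm φ (1 : A) ^ 2 = 1 := by rw [stateNorm_sq hφ]; simp [h1]
    have h4 : (φ ((Complex.I * t) • (T a + (Complex.I * (t / 2)) • T (a * a)))).re =
        - (t ^ 2 / 2 * stateNorm φ a ^ 2) := by
      rw [map_smul, map_add, map_smul, hφT, hφT, ← hφaa]
      simp [hφa]
      ring
    rw [hTu, stateNorm_add_sq hφ, h3, star_one, one_mul, h4, stateNorm_smul, mul_pow] at h2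
    simp only [norm_mul, Complex.norm_I, one_mul, Complex.norm_real, Real.norm_of_nonneg ht.le]
      at h2
    have ht2 : 0 < t ^ 2 := by positivity
    refine le_of_mul_le_mul_left ?_ ht2
    linarith
  have hlim : ∀ t : ℝ, 0 < t → stateNorm φ (T a) ≤
      √ (stateNorm φ a ^ 2 + t ^ 2 / 4 * ‖a‖ ^ 4) + t / 2 * stateNorm φ (T (a * a)) := by
    intro t ht
    have h5 := stateNorm_add_le hφ (T a + (Complex.I * (t / 2)) • T (a * a))
      (-((Complex.I * (t / 2)) • T (a * a)))
    rw [add_neg_cancel_right, stateNorm_neg, stateNorm_smul] at h5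
    have h6 : ‖Complex.I * ((t : ℂ) / 2)‖ = t / 2 := by
      simp [abs_of_pos ht]
    rw [h6] at h5
    exact h5.trans (add_le_add_left (Real.le_sqrt_of_sq_le (key t ht)) _)
  have hc : Continuous fun t : ℝ => √ (stateNorm φ a ^ 2 + t ^ 2 / 4 * ‖a‖ ^ 4) +
      t / 2 * stateNorm φ (T (a * a)) := by fun_prop
  have hc0 := (hc.tendsto 0).mono_left (nhdsWithin_le_nhds (s := Set.Ioi 0))
  have := ge_of_tendsto hc0 (eventually_mem_nhdsWithin.mono fun t ht => hlim t ht)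
  simpa [Real.sqrt_sq (stateNorm_nonneg _)] using this

/-- A real quadratic polynomial inequality forcing the linear coefficient to vanish. -/
theorem eq_zero_of_forall_mul_add_nonneg {p q : ℝ} (h : ∀ t : ℝ, 0 ≤ t * p + q) : p = 0 := by
  by_contra hp
  have := h (-(q + 1) / p)
  rw [div_mul_cancel₀ _ hp] at this
  linarith

/-- Two self-adjoint unital contractive projections with the same range and leaving a faithful
state invariant agree on self-adjoint elements. -/
theorem apply_eq_of_contractive_projections (hφ : ∀ x, 0 ≤ φ (star x * x)) (h1 : φ 1 = 1)
    (hf : ∀ x, φ (star x * x) = 0 → x = 0) {N : Submodule ℂ A} (hN : 1 ∈ N)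
    {E E' : A →L[ℂ] A} (hE : ‖E‖ ≤ 1) (hE' : ‖E'‖ ≤ 1) (hEN : ∀ x, E x ∈ N) (hEN' : ∀ x, E' x ∈ N)
    (hEs : ∀ x ∈ N, E x = x) (hEs' : ∀ x ∈ N, E' x = x)
    (hφE : ∀ x, φ (E x) = φ x) (hφE' : ∀ x, φ (E' x) = φ x)
    {a : A} (ha : star a = a) (hEa : star (E a) = E a) (hEa' : star (E' a) = E' a) :
    E' a = E a := by
  -- Kernel and range are orthogonal: `T(tb + c) = tb`, so the seminorm of `tb` is at most that of
  -- `tb + c` for every real `t`, and the cross term must vanish.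
  have key : ∀ T : A →L[ℂ] A, ‖T‖ ≤ 1 → (∀ x ∈ N, T x = x) → (∀ x, φ (T x) = φ x) →
      ∀ b ∈ N, star b = b → ∀ c, star c = c → T c = 0 →
      (φ (star b * c)).re = 0 := by
    intro T hT hTs hφT b hb hbs c hcs hc
    suffices 2 * (φ (star b * c)).re = 0 by linarith
    apply eq_zero_of_forall_mul_add_nonneg (q := stateNorm φ c ^ 2)
    intro t
    have hs : star ((t : ℂ) • b + c) = (t : ℂ) • b + c := by
      simp [star_add, star_smul, hbs, hcs]
    have h2 := stateNorm_map_le hφ h1 hT (hTs 1 hN) hφT hs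
    rw [map_add, map_smul, hc, hTs b hb, add_zero] at h2
    have h3 := pow_le_pow_left₀ (stateNorm_nonneg _) h2 2
    rw [stateNorm_add_sq hφ, star_smul, smul_mul_assoc, map_smul, smul_eq_mul, Complex.star_def,
      Complex.conj_ofReal, Complex.re_ofReal_mul] at h3
    linarith
  have hdN : E' a - E a ∈ N := N.sub_mem (hEN' a) (hEN a)
  have hds : star (E' a - E a) = E' a - E a := by rw [star_sub, hEa, hEa']
  have k1 := key E hE hEs hφE _ hdN hds (a - E a) (by rw [star_sub, ha, hEa])
    (by rw [map_sub, hEs _ (hEN a), sub_self])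
  have k2 := key E' hE' hEs' hφE' _ hdN hds (a - E' a) (by rw [star_sub, ha, hEa'])
    (by rw [map_sub, hEs' _ (hEN' a), sub_self])
  -- The difference `E' a - E a` is orthogonal to `a - E a` and to `a - E' a`, hence to itself.
  refine sub_eq_zero.1 (hf _ ?_)
  have h0 : stateNorm φ (E' a - E a) ^ 2 = 0 := by
    rw [stateNorm_sq hφ]
    have e : star (E' a - E a) * (E' a - E a) =
        star (E' a - E a) * (a - E a) - star (E' a - E a) * (a - E' a) := by
      rw [← mul_sub]; congr 1; abel
    rw [e, map_sub, Complex.sub_re, k1, k2, sub_zero]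
  rw [apply_star_mul_self hφ, h0, Complex.ofReal_zero]

end Contraction

/-! ### Uniqueness of the invariant projection -/

section Projection

variable {H : Type*} [NormedAddCommGroup H] [InnerProductSpace ℂ H] [CompleteSpace H]
  {M : VonNeumannAlgebra H}

instance completeSpace_elt (M : VonNeumannAlgebra H) : CompleteSpace (Elt M) :=
  (isClosed_toStarSubalgebra M).completeSpace_coe

/-- A unital contraction of `M` preserves self-adjoint elements. -/
theorem star_map_eq_of_contraction {T : Elt M →L[ℂ] Elt M} (hT : ‖T‖ ≤ 1) (hT1 : T 1 = 1)
    {a : Elt M} (ha : star a = a) : star (T a) = T a := by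
  have hreal : ∀ ξ : H, (⟪ξ, (T a : H →L[ℂ] H) ξ⟫_ℂ).im = 0 := by
    intro ξ
    suffices 2 * (⟪ξ, (T a : H →L[ℂ] H) ξ⟫_ℂ).im = 0 by linarith
    -- For self-adjoint `a` the norm of `1 + ita` has no term linear in `t`. A nonzero imaginary
    -- part of `⟪ξ, T(a) ξ⟫` would produce one for its image under `T`.
    have h1 : ∀ t : ℝ, ‖ξ + (Complex.I * t) • (T a : H →L[ℂ] H) ξ‖ ^ 2 ≤
        (1 + t ^ 2 * ‖a‖ ^ 2) * ‖ξ‖ ^ 2 := by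
      intro t
      let u : Elt M := 1 + (Complex.I * t) • a
      have hu : star u * u = 1 + ((t ^ 2 : ℝ) : ℂ) • (star a * a) := by
        have hs : star (Complex.I * t : ℂ) = -(Complex.I * t) := by simp
        have ht2 : ((t ^ 2 : ℝ) : ℂ) = -(Complex.I * t) ^ 2 := by
          rw [mul_pow, Complex.I_sq]; push_cast; ring
        simp only [u, star_add, star_one, star_smul, ha, hs, ht2]
        generalize Complex.I * (t : ℂ) = s
        simp only [add_mul, mul_add, one_mul, mul_one, smul_mul_assoc, mul_smul_comm]
        match_scalars <;> ring
      have hun : ‖u‖ ^ 2 ≤ 1 + t ^ 2 * ‖a‖ ^ 2 := by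
        rw [sq, ← CStarRing.norm_star_mul_self, hu]
        refine (norm_add_le _ _).trans (add_le_add ?_ ?_)
        · exact ContinuousLinearMap.norm_id_le
        · rw [norm_smul, Complex.norm_real, Real.norm_of_nonneg (by positivity),
            CStarRing.norm_star_mul_self, sq ‖a‖]
      have hTu : (T u : H →L[ℂ] H) ξ = ξ + (Complex.I * t) • (T a : H →L[ℂ] H) ξ := by
        simp [u, map_add, map_smul, hT1]
      rw [← hTu]
      calc ‖(T u : H →L[ℂ] H) ξ‖ ^ 2 ≤ (‖u‖ * ‖ξ‖) ^ 2 := by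
            gcongr
            refine ((T u : H →L[ℂ] H).le_opNorm ξ).trans ?_
            gcongr
            have := T.le_of_opNorm_le hT u
            rwa [one_mul] at this
        _ ≤ _ := by rw [mul_pow]; gcongr
    have h2 : ∀ t : ℝ, 2 * t * (⟪ξ, (T a : H →L[ℂ] H) ξ⟫_ℂ).im + t ^ 2 * (‖a‖ ^ 2 * ‖ξ‖ ^ 2) ≥ 0 := by
      intro t
      have h3 := h1 t
      rw [@norm_add_sq ℂ, inner_smul_right] at h3
      have h4 : RCLike.re (Complex.I * (t : ℂ) * ⟪ξ, (T a : H →L[ℂ] H) ξ⟫_ℂ) =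
          -(t * (⟪ξ, (T a : H →L[ℂ] H) ξ⟫_ℂ).im) := by
        simp
      rw [h4] at h3
      nlinarith [sq_nonneg ‖(Complex.I * (t : ℂ)) • (T a : H →L[ℂ] H) ξ‖]
    by_contra hne
    set p := 2 * (⟪ξ, (T a : H →L[ℂ] H) ξ⟫_ℂ).im
    set q := ‖a‖ ^ 2 * ‖ξ‖ ^ 2
    have hq : 0 < q + 1 := by positivity
    -- At this `t` the value of `tp + t²q` is `-(p/(q+1))²`; the `+ 1` covers `q = 0`.
    have h3 := h2 (-p / (q + 1))
    have e : 2 * (-p / (q + 1)) * (⟪ξ, (T a : H →L[ℂ] H) ξ⟫_ℂ).im + (-p / (q + 1)) ^ 2 * q =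
        -(p / (q + 1)) ^ 2 := by
      have : 2 * (-p / (q + 1)) * (⟪ξ, (T a : H →L[ℂ] H) ξ⟫_ℂ).im = (-p / (q + 1)) * p := by
        simp only [p]; ring
      rw [this]; field_simp; ring
    have : 0 < (p / (q + 1)) ^ 2 := by positivity
    linarith
  have hsymm : IsSelfAdjoint (T a : H →L[ℂ] H) := by
    rw [ContinuousLinearMap.isSelfAdjoint_iff_isSymmetric,
      LinearMap.isSymmetric_iff_inner_map_self_real]
    intro ξ
    have h0 := hreal ξ
    rw [← inner_conj_symm, Complex.conj_im, neg_eq_zero] at h0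
    exact Complex.conj_eq_iff_im.2 h0
  exact Subtype.ext hsymm

theorem IsNormalNormOneProjection.eq_of_invariant {N : StarSubalgebra ℂ (Elt M)}
    {φ : StrongDual ℂ (Elt M)} (hφ : IsFaithfulNormalState M φ) {E E' : Elt M →L[ℂ] Elt M}
    (hE : IsNormalNormOneProjection M N E) (hφE : φ.comp E = φ)
    (hE' : IsNormalNormOneProjection M N E') (hφE' : φ.comp E' = φ) : E' = E := by
  have hEs := fun a (ha : star a = a) =>
    star_map_eq_of_contraction hE.norm_eq_one.le (hE.map_eq_self 1 N.one_mem) ha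
  have hEs' := fun a (ha : star a = a) =>
    star_map_eq_of_contraction hE'.norm_eq_one.le (hE'.map_eq_self 1 N.one_mem) ha
  have hsa : ∀ a : Elt M, star a = a → E' a = E a := fun a ha =>
    apply_eq_of_contractive_projections (N := Subalgebra.toSubmodule N.toSubalgebra)
      hφ.nonneg hφ.map_one hφ.faithful N.one_mem hE.norm_eq_one.le hE'.norm_eq_one.le hE.map_mem
      hE'.map_mem hE.map_eq_self hE'.map_eq_self (fun x => congrArg (fun f => f x) hφE)
      (fun x => congrArg (fun f => f x) hφE') ha (hEs a ha) (hEs' a ha)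
  ext1 x
  rw [← realPart_add_I_smul_imaginaryPart x]
  rw [map_add, map_add, map_smul, map_smul, hsa _ (realPart x).2, hsa _ (imaginaryPart x).2]

end Projection

/-! ### Mean ergodic theorem in the seminorm -/

section MeanErgodic

variable {A : Type*} [NormedRing A] [StarRing A] [NormedAlgebra ℂ A] [StarModule ℂ A]
  {φ : StrongDual ℂ A}

/-- Mean ergodic theorem for the Hilbert seminorm of `φ`: averages that are asymptotically
invariant under seminorm-preserving maps and fix almost invariant elements up to a small error
are Cauchy. -/
theorem exists_forall_stateNorm_sub_le (hφ : ∀ x, 0 ≤ φ (star x * x)) {ι : Type*}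
    (α : ι → A → A) (hα : ∀ k y, stateNorm φ (α k y) = stateNorm φ y) (T : ℕ → A →L[ℂ] A)
    (hT : ∀ k y, Tendsto (fun n => stateNorm φ (T n y - T n (α k y))) atTop (𝓝 0))
    (hT' : ∀ n y (ε : ℝ), (∀ k, stateNorm φ (α k y - y) ≤ ε) → stateNorm φ (T n y - y) ≤ ε)
    (b : A) {ε : ℝ} (hε : 0 < ε) :
    ∃ N, ∀ n ≥ N, ∀ l ≥ N, stateNorm φ (T n b - T l b) ≤ ε := by
  -- The elements with the same asymptotic averages as `b`; this set is stable under each `α k` and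
  -- under midpoints.
  let C : Set A := {y | Tendsto (fun n => stateNorm φ (T n b - T n y)) atTop (𝓝 0)}
  have hbC : b ∈ C := by simp [C, stateNorm]
  have hαC : ∀ k, ∀ y ∈ C, α k y ∈ C := fun k y hy => by
    have h := Tendsto.add hy (hT k y)
    rw [add_zero] at h
    exact squeeze_zero (fun _ => stateNorm_nonneg _) (fun n => stateNorm_sub_le hφ _ _ _) h
  have hmid : ∀ y ∈ C, ∀ z ∈ C, (1 / 2 : ℂ) • (y + z) ∈ C := fun y hy z hz => by
    have h := (Tendsto.add hy hz).const_mul (1 / 2 : ℝ)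
    rw [add_zero, mul_zero] at h
    refine squeeze_zero (fun _ => stateNorm_nonneg _) (fun n => ?_) h
    have e : T n b - T n ((1 / 2 : ℂ) • (y + z)) =
        (1 / 2 : ℂ) • ((T n b - T n y) + (T n b - T n z)) := by
      rw [map_smul, map_add]; module
    rw [e, stateNorm_smul]
    have : ‖(1 / 2 : ℂ)‖ = 1 / 2 := by norm_num
    rw [this]
    have := stateNorm_add_le hφ (T n b - T n y) (T n b - T n z)
    gcongr
  let S : Set ℝ := (fun y => stateNorm φ y ^ 2) '' C
  have hSb : BddBelow S := ⟨0, by rintro _ ⟨y, -, rfl⟩; positivity⟩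
  have hSne : S.Nonempty := ⟨_, b, hbC, rfl⟩
  obtain ⟨_, ⟨y, hyC, rfl⟩, hy⟩ := exists_lt_of_csInf_lt hSne
    (show sInf S < sInf S + (ε / 8) ^ 2 by have : 0 < (ε / 8) ^ 2 := by positivity
                                           linarith)
  -- Near-minimality of `y` forces almost invariance: the midpoint of `α k y` and `y` lies in `C`,
  -- so the parallelogram law bounds the square of the left side by `4 (ε/8)²`.
  have hyα : ∀ k, stateNorm φ (α k y - y) ≤ ε / 4 := fun k => by
    have h1 := csInf_le hSb ⟨_, hmid _ (hαC k y hyC) y hyC, rfl⟩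
    have h2 := stateNorm_parallelogram hφ (α k y) y
    have : ‖(1 / 2 : ℂ)‖ = 1 / 2 := by norm_num
    simp only [stateNorm_smul, this, mul_pow] at h1
    rw [hα] at h2
    refine le_of_sq_le_sq ?_ (by positivity)
    simp only at hy
    nlinarith
  obtain ⟨N, hN⟩ := eventually_atTop.1
    ((show Tendsto _ _ _ from hyC).eventually (gt_mem_nhds (show (0 : ℝ) < ε / 4 by positivity)))
  have hNb : ∀ n ≥ N, stateNorm φ (T n b - y) ≤ ε / 2 := fun n hn => by
    have h1 := stateNorm_sub_le hφ (T n b) (T n y) y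
    have h2 := hT' n y _ hyα
    linarith [hN n hn]
  refine ⟨N, fun n hn l hl => ?_⟩
  have h1 := stateNorm_sub_le hφ (T n b) y (T l b)
  rw [stateNorm_sub_comm y] at h1
  linarith [hNb n hn, hNb l hl]

end MeanErgodic

/-! ### Strong convergence of contractions -/

section Cauchy

variable {V W : Type*} [NormedAddCommGroup V] [NormedSpace ℂ V] [NormedAddCommGroup W]
  [NormedSpace ℂ W]

/-- The vectors at which a sequence of linear maps is Cauchy. -/
def cauchySubmodule (T : ℕ → V →ₗ[ℂ] W) : Submodule ℂ V where
  carrier := {v | CauchySeq fun n => T n v}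
  add_mem' := fun {v w} hv hw => by simpa using! CauchySeq.add hv hw
  zero_mem' := by simpa using cauchySeq_const (0 : W)
  smul_mem' := fun c v hv => by
    simpa using! (uniformContinuous_const_smul c).comp_cauchySeq hv

theorem isClosed_cauchySubmodule {T : ℕ → V →ₗ[ℂ] W} (hT : ∀ n v, ‖T n v‖ ≤ ‖v‖) :
    IsClosed (cauchySubmodule T : Set V) := by
  refine isClosed_of_closure_subset fun v hv => ?_
  change CauchySeq fun n => T n v
  rw [Metric.cauchySeq_iff]
  intro ε hε
  obtain ⟨w, hw, hvw⟩ := Metric.mem_closure_iff.1 hv (ε / 3) (by positivity)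
  obtain ⟨N, hN⟩ := Metric.cauchySeq_iff.1 (show CauchySeq fun n => T n w from hw) (ε / 3)
    (by positivity)
  have h : ∀ n, dist (T n v) (T n w) < ε / 3 := fun n => by
    rw [dist_eq_norm, ← map_sub]
    exact (hT n _).trans_lt (by rwa [← dist_eq_norm])
  refine ⟨N, fun k hk l hl => ?_⟩
  have h1 := dist_triangle4 (T k v) (T k w) (T l w) (T l v)
  have h2 := h l
  rw [dist_comm] at h2
  linarith [h k, hN k hk l hl]

end Cauchy

/-! ### Følner sets -/

section Folner

variable {G : Type*} [Group G] [TopologicalSpace G] [IsTopologicalGroup G] [T2Space G]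
  [MeasurableSpace G] [BorelSpace G] {m : Measure G} [m.IsHaarMeasure]

/-- Left invariance turns the first integral into that of `h` over `kF`; the parts over `F ∩ kF`
cancel. -/
theorem norm_setIntegral_mul_left_sub_le {F : Set G} (hF : IsCompact F) (k : G) {h : G → ℂ}
    (hm : AEStronglyMeasurable h m) {C : ℝ} (hC : ∀ g, ‖h g‖ ≤ C) :
    ‖(∫ g in F, h (k * g) ∂m) - ∫ g in F, h g ∂m‖ ≤ C * m.real (F ∆ ({k} * F)) := by
  have hK : IsCompact ({k} * F) := isCompact_singleton.mul hF
  have hFm := hF.measurableSet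
  have hKm := hK.measurableSet
  have hint : ∀ {S : Set G}, m S ≠ ⊤ → IntegrableOn h S m := fun hS =>
    Measure.integrableOn_of_bounded hS hm (ae_of_all _ hC)
  have hFt : m F ≠ ⊤ := hF.measure_ne_top
  have hKt : m ({k} * F) ≠ ⊤ := hK.measure_ne_top
  have e1 : ∫ g in F, h (k * g) ∂m = ∫ g in {k} * F, h g ∂m := by
    have := (measurePreserving_mul_left m k).setIntegral_image_emb
      (measurableEmbedding_mulLeft k) h F
    rw [Set.singleton_mul, this]
  have hd : ∀ S S' : Set G, m S ≠ ⊤ → ‖∫ g in S \ S', h g ∂m‖ ≤ C * m.real (S \ S') :=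
    fun S S' hS => norm_setIntegral_le_of_norm_le_const
      ((measure_mono Set.sdiff_subset).trans_lt hS.lt_top) (fun g _ => hC g)
  have e3 : m.real (F ∆ ({k} * F)) = m.real (F \ ({k} * F)) + m.real (({k} * F) \ F) := by
    rw [Set.symmDiff_def]
    exact measureReal_union (Set.disjoint_left.2 fun x h1 h2 => h1.2 h2.1) (hKm.diff hFm)
      ((measure_mono Set.sdiff_subset).trans_lt hFt.lt_top).ne
      ((measure_mono Set.sdiff_subset).trans_lt hKt.lt_top).ne
  have i1 := setIntegral_union (μ := m) (f := h)
    (Set.disjoint_left.2 fun x (h1 : x ∈ F ∩ ({k} * F)) (h2 : x ∈ F \ ({k} * F)) => h2.2 h1.2)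
    (hFm.diff hKm) (hint (measure_mono Set.inter_subset_left |>.trans_lt hFt.lt_top).ne)
    (hint (measure_mono Set.sdiff_subset |>.trans_lt hFt.lt_top).ne)
  have i2 := setIntegral_union (μ := m) (f := h)
    (Set.disjoint_left.2 fun x (h1 : x ∈ ({k} * F) ∩ F) (h2 : x ∈ ({k} * F) \ F) => h2.2 h1.2)
    (hKm.diff hFm) (hint (measure_mono Set.inter_subset_left |>.trans_lt hKt.lt_top).ne)
    (hint (measure_mono Set.sdiff_subset |>.trans_lt hKt.lt_top).ne)
  rw [Set.inter_union_sdiff] at i1 i2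
  rw [e1, i1, i2, Set.inter_comm, add_sub_add_left_eq_sub, e3, mul_add]
  refine (norm_sub_le _ _).trans ?_
  linarith [hd _ F hKt, hd _ ({k} * F) hFt]

omit [IsTopologicalGroup G] [T2Space G] [BorelSpace G] in
theorem IsFolnerSeq.tendsto {F : ℕ → Set G} (hF : IsFolnerSeq m F) (k : G) :
    Tendsto (fun n => (m.real (F n))⁻¹ * m.real (F n ∆ ({k} * F n))) atTop (𝓝 0) := by
  rw [Metric.tendsto_atTop]
  intro ε hε
  obtain ⟨N, hN⟩ := hF.eventually_invariant {k} isCompact_singleton (Set.singleton_nonempty k)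
    ε hε
  refine ⟨N, fun n hn => ?_⟩
  obtain ⟨-, h⟩ := hN n hn
  have hFt : m (F n) ≠ ⊤ := (hF.isCompact n).measure_ne_top
  have h' : m.real (F n ∆ ({k} * F n)) < ε * m.real (F n) := by
    have := (ENNReal.toReal_lt_toReal h.ne_top (ENNReal.mul_ne_top ENNReal.ofReal_ne_top hFt)).2 h
    rwa [ENNReal.toReal_mul, ENNReal.toReal_ofReal hε.le] at this
  have hpos : 0 < m.real (F n) := by
    rcases (measureReal_nonneg (μ := m) (s := F n)).eq_or_lt with h0 | h0
    · rw [← h0, mul_zero] at h'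
      exact absurd h' (not_lt.2 measureReal_nonneg)
    · exact h0
  rw [Real.dist_0_eq_abs, abs_of_nonneg (by positivity), inv_mul_lt_iff₀ hpos]
  linarith

omit [IsTopologicalGroup G] [T2Space G] [BorelSpace G] in
-- The strict inequality in temperedness is impossible when `|F_n| = 0`.
theorem IsTempered.measureReal_pos {F : ℕ → Set G} (hT : IsTempered m F)
    (hF : ∀ n, IsCompact (F n)) (n : ℕ) : 0 < m.real (F n) := by
  obtain ⟨C, -, h⟩ := hT
  refine ENNReal.toReal_pos (fun h0 => ?_) (hF n).measure_ne_top
  have := h n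
  simp [h0] at this

end Folner

/-! ### The dense functionals `φ(a* ·)` -/

section StateFunctional

variable {H : Type*} [NormedAddCommGroup H] [InnerProductSpace ℂ H] [CompleteSpace H]
  {M : VonNeumannAlgebra H}

/-- A map is normal if it pulls the functionals in a dense subspace of `M_*` back to `M_*`. -/
theorem IsNormalMap.of_subset {R : Elt M →L[ℂ] Elt M} {S : Set (StrongDual ℂ (Elt M))}
    (hS : predual M ≤ (Submodule.span ℂ S).topologicalClosure)
    (h : ∀ ψ ∈ S, ψ.comp R ∈ predual M) : IsNormalMap M R := by
  let Φ : StrongDual ℂ (Elt M) →L[ℂ] StrongDual ℂ (Elt M) := ContinuousLinearMap.precomp ℂ R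
  have hle : predual M ≤ (predual M).comap Φ.toLinearMap :=
    hS.trans (Submodule.topologicalClosure_minimal _ (Submodule.span_le.2 h)
      (isClosed_predual.preimage Φ.continuous))
  exact fun ψ hψ => hle hψ

theorem isNormalMap_mul_left (b : Elt M) :
    IsNormalMap M (ContinuousLinearMap.mul ℂ (Elt M) b) := by
  refine IsNormalMap.of_subset le_rfl ?_
  rintro _ ⟨ξ, η, rfl⟩
  convert vectorFunctional_mem_predual (M := M) ((star (b : H →L[ℂ] H)) ξ) η using 1
  ext x
  simp [ContinuousLinearMap.star_eq_adjoint, ContinuousLinearMap.adjoint_inner_left]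

/-- The functional `x ↦ φ(a* x)`. -/
noncomputable def stateFunctional (φ : StrongDual ℂ (Elt M)) (a : Elt M) :
    StrongDual ℂ (Elt M) :=
  φ.comp (ContinuousLinearMap.mul ℂ (Elt M) (star a))

@[simp]
theorem stateFunctional_apply (φ : StrongDual ℂ (Elt M)) (a x : Elt M) :
    stateFunctional φ a x = φ (star a * x) := rfl

theorem stateFunctional_mem_predual {φ : StrongDual ℂ (Elt M)} (hφ : φ ∈ predual M) (a : Elt M) :
    stateFunctional φ a ∈ predual M :=
  isNormalMap_mul_left (star a) φ hφ

variable {φ : StrongDual ℂ (Elt M)}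

/-- The functionals `x ↦ φ(a* x)` are dense in `M_*` if `φ` is a faithful normal state. -/
theorem IsFaithfulNormalState.predual_le (hφ : IsFaithfulNormalState M φ) :
    predual M ≤ (Submodule.span ℂ (Set.range (stateFunctional φ))).topologicalClosure := by
  refine predual_le_topologicalClosure (Submodule.span_le.2 ?_) fun x hx => ?_
  · rintro _ ⟨a, rfl⟩
    exact stateFunctional_mem_predual hφ.normal a
  -- Separation of points: take `a = x`.
  · exact hφ.faithful x (hx _ (Submodule.subset_span ⟨x, rfl⟩))

/-- Transfers Cauchy estimates from the seminorm on `M` to the norm of `M_*`. -/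
theorem IsFaithfulNormalState.norm_stateFunctional_le (hφ : IsFaithfulNormalState M φ)
    (a : Elt M) : ‖stateFunctional φ a‖ ≤ stateNorm φ a :=
  ContinuousLinearMap.opNorm_le_bound _ (stateNorm_nonneg a) fun x =>
    (norm_apply_star_mul_le hφ.nonneg a x).trans (mul_le_mul_of_nonneg_left
      (stateNorm_le_norm hφ.nonneg hφ.map_one x) (stateNorm_nonneg a))

end StateFunctional

/-! ### State-preserving automorphisms -/

section Automorphism

variable {H : Type*} [NormedAddCommGroup H] [InnerProductSpace ℂ H] [CompleteSpace H]
  {M : VonNeumannAlgebra H} {φ : StrongDual ℂ (Elt M)}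

/-- A `*`-automorphism of `M` as a bounded linear map. -/
noncomputable def autCLM (α : Elt M ≃⋆ₐ[ℂ] Elt M) : Elt M →L[ℂ] Elt M :=
  LinearMap.mkContinuous
    { toFun := α
      map_add' := map_add α
      map_smul' := map_smul α } 1 fun x => by
    rw [one_mul]; exact (norm_starAlgEquiv_apply α x).le

@[simp]
theorem autCLM_apply (α : Elt M ≃⋆ₐ[ℂ] Elt M) (x : Elt M) : autCLM α x = α x := rfl

theorem norm_autCLM_le (α : Elt M ≃⋆ₐ[ℂ] Elt M) : ‖autCLM α‖ ≤ 1 :=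
  LinearMap.mkContinuous_norm_le _ zero_le_one _

variable {G : Type*} [Group G] {α : G →* (Elt M ≃⋆ₐ[ℂ] Elt M)}

theorem apply_inv_apply (g : G) (x : Elt M) : α g⁻¹ (α g x) = x := by
  rw [← StarAlgEquiv.mul_apply, ← map_mul, inv_mul_cancel, map_one, StarAlgEquiv.one_apply]

theorem apply_mul (g h : G) (x : Elt M) : α (g * h) x = α g (α h x) := by
  rw [map_mul, StarAlgEquiv.mul_apply]

theorem state_star_mul_apply (hinv : ∀ g x, φ (α g x) = φ x) (g : G) (a x : Elt M) :
    φ (star a * α g x) = φ (star (α g⁻¹ a) * x) := by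
  rw [← hinv g⁻¹, map_mul, map_star, apply_inv_apply]

theorem stateNorm_apply (hinv : ∀ g x, φ (α g x) = φ x) (g : G) (x : Elt M) :
    stateNorm φ (α g x) = stateNorm φ x := by
  rw [stateNorm, ← map_star, ← map_mul, hinv, stateNorm]

/-- Automorphisms in a group leaving a faithful normal state invariant are normal. -/
theorem isNormalMap_autCLM (hφ : IsFaithfulNormalState M φ) (hinv : ∀ g x, φ (α g x) = φ x)
    (g : G) : IsNormalMap M (autCLM (α g)) := by
  refine IsNormalMap.of_subset hφ.predual_le ?_
  rintro _ ⟨a, rfl⟩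
  convert stateFunctional_mem_predual hφ.normal (α g⁻¹ a) using 1
  ext x
  exact state_star_mul_apply hinv g a x

end Automorphism

/-! ### Averages over a single set -/

section Averages

variable {H : Type*} [NormedAddCommGroup H] [InnerProductSpace ℂ H] [CompleteSpace H]
  {M : VonNeumannAlgebra H} {φ : StrongDual ℂ (Elt M)}

/-- `T(x) = |F|⁻¹ ∫_F β_g(x) dm(g)` as a weak* integral. -/
def IsWeakAverage {G : Type*} [MeasurableSpace G] (β : G → Elt M → Elt M) (m : Measure G)
    (F : Set G) (T : Elt M →L[ℂ] Elt M) : Prop :=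
  ∀ x : Elt M, ∀ ψ ∈ predual M, IntegrableOn (fun g => ψ (β g x)) F m ∧
    ψ (T x) = (m.real F)⁻¹ • ∫ g in F, ψ (β g x) ∂m

section Basic

variable {G : Type*} [MeasurableSpace G] {m : Measure G} {F : Set G} {β : G → Elt M → Elt M}
  {T : Elt M →L[ℂ] Elt M}

theorem exists_isWeakAverage (hF : m F ≠ ⊤) (γ : G → Elt M →L[ℂ] Elt M) (hγ : ∀ g, ‖γ g‖ ≤ 1)
    (hm : ∀ x : Elt M, ∀ ψ ∈ predual M, AEMeasurable (fun g => ψ (γ g x)) m) :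
    ∃ T : Elt M →L[ℂ] Elt M, ‖T‖ ≤ 1 ∧ IsWeakAverage (fun g => γ g) m F T := by
  have : IsFiniteMeasure (m.restrict F) := ⟨by simpa using hF.lt_top⟩
  obtain ⟨T, hT, h⟩ := exists_average (m.restrict F) γ hγ fun x ψ hψ => (hm x ψ hψ).restrict
  refine ⟨T, hT, fun x ψ hψ => ⟨(h x ψ hψ).1, ?_⟩⟩
  simpa using (h x ψ hψ).2

theorem IsWeakAverage.apply_sub (hT : IsWeakAverage β m F T) (hF : 0 < m.real F)
    {ψ : StrongDual ℂ (Elt M)} (hψ : ψ ∈ predual M) (x z : Elt M) :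
    ψ (T x - z) = (m.real F)⁻¹ • ∫ g in F, ψ (β g x - z) ∂m := by
  have hFt : m F ≠ ⊤ := fun h => by simp [measureReal_def, h] at hF
  obtain ⟨h1, h2⟩ := hT x ψ hψ
  simp only [map_sub]
  rw [integral_sub h1 (integrableOn_const hFt), h2, setIntegral_const, smul_sub,
    inv_smul_smul₀ hF.ne']

theorem IsWeakAverage.apply_eq (hT : IsWeakAverage β m F T) (hF : 0 < m.real F) {x z : Elt M}
    (h : ∀ g, β g x = z) : T x = z :=
  eq_of_forall_predual fun ψ hψ => by
    have := hT.apply_sub hF hψ x z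
    simp only [h, sub_self, map_zero, integral_zero, smul_zero] at this
    rwa [map_sub, sub_eq_zero] at this

/-- The integral is only weak*, so the bound comes from testing it on `φ(d* ·)` with `d = T x - z`
and applying Cauchy–Schwarz under the integral. -/
theorem IsWeakAverage.stateNorm_sub_le (hT : IsWeakAverage β m F T) (hF : 0 < m.real F)
    (hφ : IsFaithfulNormalState M φ) {x z : Elt M} {ε : ℝ}
    (h : ∀ g, stateNorm φ (β g x - z) ≤ ε) (hε : 0 ≤ ε) : stateNorm φ (T x - z) ≤ ε := by
  have hFt : m F ≠ ⊤ := fun h => by simp [measureReal_def, h] at hF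
  have h1 := hT.apply_sub hF (stateFunctional_mem_predual hφ.normal (T x - z)) x z
  have h2 : ‖stateFunctional φ (T x - z) (T x - z)‖ ≤ stateNorm φ (T x - z) * ε := by
    rw [h1, norm_smul, norm_inv, Real.norm_of_nonneg hF.le, inv_mul_le_iff₀ hF, mul_comm]
    refine norm_setIntegral_le_of_norm_le_const hFt.lt_top fun g _ => ?_
    exact (norm_apply_star_mul_le hφ.nonneg _ _).trans
      (mul_le_mul_of_nonneg_left (h g) (stateNorm_nonneg _))
  rw [stateFunctional_apply, apply_star_mul_self hφ.nonneg, Complex.norm_real,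
    Real.norm_of_nonneg (sq_nonneg _), sq] at h2
  rcases (stateNorm_nonneg (φ := φ) (T x - z)).eq_or_lt with h0 | h0
  · rwa [← h0]
  · exact le_of_mul_le_mul_left h2 h0

end Basic

variable {G : Type*} [Group G] [MeasurableSpace G] {m : Measure G} {F : Set G}
  {α : G →* (Elt M ≃⋆ₐ[ℂ] Elt M)} {T S : Elt M →L[ℂ] Elt M}

/-- The averages of `α_g` and of `α_{g⁻¹}` are adjoint to each other for the form `φ(a* x)`. -/
theorem stateFunctional_comp_average (hφ : IsFaithfulNormalState M φ)
    (hinv : ∀ g x, φ (α g x) = φ x) (hT : IsWeakAverage (fun g => α g) m F T)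
    (hS : IsWeakAverage (fun g => α g⁻¹) m F S) (a : Elt M) :
    (stateFunctional φ a).comp T = stateFunctional φ (S a) := by
  ext x
  have h1 := (hT x _ (stateFunctional_mem_predual hφ.normal a)).2
  have h2 := (hS a _ (stateFunctional_mem_predual hφ.normal x)).2
  rw [ContinuousLinearMap.comp_apply, h1, stateFunctional_apply, ← apply_star_mul_comm hφ.nonneg]
  rw [stateFunctional_apply] at h2
  rw [h2, Complex.real_smul, Complex.real_smul, map_mul, Complex.conj_ofReal, ← integral_conj]
  simp only [stateFunctional_apply, apply_star_mul_comm hφ.nonneg, state_star_mul_apply hinv, inv_inv]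

theorem isNormalMap_average (hφ : IsFaithfulNormalState M φ)
    (hinv : ∀ g x, φ (α g x) = φ x) (hT : IsWeakAverage (fun g => α g) m F T)
    (hS : IsWeakAverage (fun g => α g⁻¹) m F S) : IsNormalMap M T := by
  refine IsNormalMap.of_subset hφ.predual_le ?_
  rintro _ ⟨a, rfl⟩
  rw [stateFunctional_comp_average hφ hinv hT hS]
  exact stateFunctional_mem_predual hφ.normal _

theorem isCompletelyPositive_average (hT : IsWeakAverage (fun g => α g) m F T) :
    IsCompletelyPositive M T := by
  intro k B ξ
  have h : ∀ i j, ⟪ξ i, ((T ((B.conjTranspose * B) i j) : Elt M) : H →L[ℂ] H) (ξ j)⟫_ℂ =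
      (m.real F)⁻¹ • ∫ g in F, vectorFunctional M (ξ i) (ξ j)
        (α g ((B.conjTranspose * B) i j)) ∂m := fun i j =>
    (hT _ _ (vectorFunctional_mem_predual (ξ i) (ξ j))).2
  have hint := fun i j => (hT ((B.conjTranspose * B) i j) _
    (vectorFunctional_mem_predual (ξ i) (ξ j))).1
  simp only [h, ← Finset.smul_sum]
  rw [Finset.sum_congr rfl fun i _ => (integral_finsetSum _ fun j _ => hint i j).symm,
    ← integral_finsetSum _ fun i _ => integrable_finsetSum _ fun j _ => hint i j]
  refine smul_nonneg (inv_nonneg.2 measureReal_nonneg) (integral_nonneg fun g => ?_)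
  -- Each `α g` is a `*`-homomorphism, so the integrand is the sum over `l` of `‖∑ i, α g (B l i) ξ
  -- i‖²`.
  have e : ∑ i, ∑ j, vectorFunctional M (ξ i) (ξ j) (α g ((B.conjTranspose * B) i j)) =
      ∑ l, ⟪∑ i, (α g (B l i) : H →L[ℂ] H) (ξ i), ∑ j, (α g (B l j) : H →L[ℂ] H) (ξ j)⟫_ℂ := by
    have e1 : ∀ i j, vectorFunctional M (ξ i) (ξ j) (α g ((B.conjTranspose * B) i j)) =
        ∑ l, ⟪(α g (B l i) : H →L[ℂ] H) (ξ i), (α g (B l j) : H →L[ℂ] H) (ξ j)⟫_ℂ := by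
      intro i j
      rw [Matrix.mul_apply, map_sum, map_sum]
      refine Finset.sum_congr rfl fun l _ => ?_
      rw [map_mul, Matrix.conjTranspose_apply, map_star, vectorFunctional_apply,
        ← ContinuousLinearMap.adjoint_inner_right]
      rfl
    simp only [e1, sum_inner, inner_sum]
    rw [Finset.sum_congr rfl fun i _ => Finset.sum_comm, Finset.sum_comm]
    exact Finset.sum_congr rfl fun l _ => Finset.sum_comm
  simp only
  rw [e]
  exact Finset.sum_nonneg fun l _ => by
    rw [inner_self_eq_norm_sq_to_K]; positivity

end Averages

/-! ### Asymptotic invariance and convergence on `M_*` -/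

section FolnerAverages

variable {H : Type*} [NormedAddCommGroup H] [InnerProductSpace ℂ H] [CompleteSpace H]
  {M : VonNeumannAlgebra H} {φ : StrongDual ℂ (Elt M)}
  {G : Type*} [Group G] [TopologicalSpace G] [IsTopologicalGroup G] [T2Space G]
  [MeasurableSpace G] [BorelSpace G] {m : Measure G} [m.IsHaarMeasure]
  {α : G →* (Elt M ≃⋆ₐ[ℂ] Elt M)}

/-- Here `y` is the average over `kF`, up to the change of variables. This form covers both `α_k ∘
s_n` and `S_n ∘ α_k`. -/
theorem IsWeakAverage.norm_sub_le_of_translate {F : Set G} (hF : IsCompact F)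
    {β : G → Elt M → Elt M} {T : Elt M →L[ℂ] Elt M} (hT : IsWeakAverage β m F T)
    {x y : Elt M} {k : G} (hβ : ∀ g, ‖β g x‖ ≤ ‖x‖)
    (hm : ∀ ψ ∈ predual M, AEMeasurable (fun g => ψ (β g x)) m)
    (hy : ∀ ψ ∈ predual M, ψ y = (m.real F)⁻¹ • ∫ g in F, ψ (β (k * g) x) ∂m) :
    ‖y - T x‖ ≤ ‖x‖ * ((m.real F)⁻¹ * m.real (F ∆ ({k} * F))) := by
  refine norm_le_of_forall_predual (by positivity) fun ψ hψ => ?_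
  have hb : ∀ g, ‖ψ (β g x)‖ ≤ ‖ψ‖ * ‖x‖ := fun g =>
    (ψ.le_opNorm _).trans (mul_le_mul_of_nonneg_left (hβ g) (norm_nonneg _))
  have h := norm_setIntegral_mul_left_sub_le hF k (hm ψ hψ).aestronglyMeasurable hb
  rw [map_sub, hy ψ hψ, (hT x ψ hψ).2, ← smul_sub, norm_smul, norm_inv,
    Real.norm_of_nonneg measureReal_nonneg]
  refine (mul_le_mul_of_nonneg_left h (by positivity)).trans_eq ?_
  ring

variable {F : ℕ → Set G} {s S : ℕ → Elt M →L[ℂ] Elt M}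

theorem tendsto_norm_apply_average_sub (hF : IsFolnerSeq m F)
    (hα : ∀ x : Elt M, ∀ ψ ∈ predual M, AEMeasurable (fun g => ψ (α g x)) m)
    (hφ : IsFaithfulNormalState M φ) (hinv : ∀ g x, φ (α g x) = φ x)
    (hs : ∀ n, IsWeakAverage (fun g => α g) m (F n) (s n)) (k : G) (x : Elt M) :
    Tendsto (fun n => ‖α k (s n x) - s n x‖) atTop (𝓝 0) := by
  have h := (hF.tendsto k).const_mul ‖x‖
  rw [mul_zero] at h
  refine squeeze_zero (fun _ => norm_nonneg _) (fun n => ?_) h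
  refine (hs n).norm_sub_le_of_translate (hF.isCompact n)
    (fun g => (norm_starAlgEquiv_apply (α g) x).le) (hα x) fun ψ hψ => ?_
  refine (hs n x _ (isNormalMap_autCLM hφ hinv k ψ hψ)).2.trans ?_
  simp only [ContinuousLinearMap.comp_apply, autCLM_apply, apply_mul]

theorem tendsto_norm_average_apply_sub (hF : IsFolnerSeq m F)
    (hα : ∀ x : Elt M, ∀ ψ ∈ predual M, AEMeasurable (fun g => ψ (α g⁻¹ x)) m)
    (hS : ∀ n, IsWeakAverage (fun g => α g⁻¹) m (F n) (S n)) (k : G) (x : Elt M) :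
    Tendsto (fun n => ‖S n (α k x) - S n x‖) atTop (𝓝 0) := by
  -- Since `g⁻¹ k = (k⁻¹ g)⁻¹`, composing with `α_k` on the right is a left translation by `k⁻¹`, so
  -- the same one-sided Følner condition applies.
  have h := (hF.tendsto k⁻¹).const_mul ‖x‖
  rw [mul_zero] at h
  refine squeeze_zero (fun _ => norm_nonneg _) (fun n => ?_) h
  refine (hS n).norm_sub_le_of_translate (hF.isCompact n)
    (fun g => (norm_starAlgEquiv_apply (α g⁻¹) x).le) (hα x) fun ψ hψ => ?_
  rw [(hS n (α k x) ψ hψ).2]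
  simp only [mul_inv_rev, inv_inv, apply_mul]

theorem cauchySeq_comp_average (hF : IsFolnerSeq m F) (hpos : ∀ n, 0 < m.real (F n))
    (hα : ∀ x : Elt M, ∀ ψ ∈ predual M, AEMeasurable (fun g => ψ (α g⁻¹ x)) m)
    (hφ : IsFaithfulNormalState M φ) (hinv : ∀ g x, φ (α g x) = φ x)
    (hs1 : ∀ n, ‖s n‖ ≤ 1)
    (hs : ∀ n, IsWeakAverage (fun g => α g) m (F n) (s n))
    (hS : ∀ n, IsWeakAverage (fun g => α g⁻¹) m (F n) (S n))
    {ψ : StrongDual ℂ (Elt M)} (hψ : ψ ∈ predual M) : CauchySeq fun n => ψ.comp (s n) := by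
  let Φ : ℕ → StrongDual ℂ (Elt M) →ₗ[ℂ] StrongDual ℂ (Elt M) := fun n =>
    (ContinuousLinearMap.precomp ℂ (s n)).toLinearMap
  have hΦ : ∀ n ψ, ‖Φ n ψ‖ ≤ ‖ψ‖ := fun n ψ =>
    (ContinuousLinearMap.opNorm_comp_le ψ (s n)).trans
      (mul_le_of_le_one_right (norm_nonneg _) (hs1 n))
  -- Contractivity makes the Cauchy vectors a closed subspace, so the functionals `φ(a* ·)` suffice;
  -- on these the sequence is `φ(S_n(a)* ·)`.
  have hle : predual M ≤ cauchySubmodule Φ := by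
    refine hφ.predual_le.trans (Submodule.topologicalClosure_minimal _
      (Submodule.span_le.2 ?_) (isClosed_cauchySubmodule hΦ))
    rintro _ ⟨a, rfl⟩
    change CauchySeq fun n => (stateFunctional φ a).comp (s n)
    simp only [fun n => stateFunctional_comp_average hφ hinv (hs n) (hS n) a]
    rw [Metric.cauchySeq_iff]
    intro ε hε
    obtain ⟨N, hN⟩ := exists_forall_stateNorm_sub_le hφ.nonneg (fun k => α k)
      (stateNorm_apply hinv) S
      (fun k y => squeeze_zero (fun _ => stateNorm_nonneg _)
        (fun n => by
          rw [stateNorm_sub_comm]; exact stateNorm_le_norm hφ.nonneg hφ.map_one _)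
        (tendsto_norm_average_apply_sub hF hα hS k y))
      (fun n y ε h => (hS n).stateNorm_sub_le (hpos n) hφ (fun g => h g⁻¹)
        ((stateNorm_nonneg _).trans (h 1))) a (half_pos hε)
    refine ⟨N, fun n hn l hl => ?_⟩
    have e : stateFunctional φ (S n a) - stateFunctional φ (S l a) =
        stateFunctional φ (S n a - S l a) := by
      ext x; simp [sub_mul]
    rw [dist_eq_norm, e]
    linarith [hφ.norm_stateFunctional_le (S n a - S l a), hN n hn l hl]
  exact hle hψ

end FolnerAverages

/-! ### The limit map -/

section Limit

variable {H : Type*} [NormedAddCommGroup H] [InnerProductSpace ℂ H] [CompleteSpace H]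
  {M : VonNeumannAlgebra H}

/-- Contractions whose preadjoints converge strongly on `M_*` have a normal limit. -/
theorem exists_normal_limit {s : ℕ → Elt M →L[ℂ] Elt M} (hs1 : ∀ n, ‖s n‖ ≤ 1)
    (hsn : ∀ n, IsNormalMap M (s n))
    (hc : ∀ ψ ∈ predual M, CauchySeq fun n => ψ.comp (s n)) :
    ∃ E : Elt M →L[ℂ] Elt M, ‖E‖ ≤ 1 ∧ IsNormalMap M E ∧
      ∀ ψ ∈ predual M, Tendsto (fun n => ψ.comp (s n)) atTop (𝓝 (ψ.comp E)) := by
  have hex : ∀ ψ : StrongDual ℂ (Elt M), ∃ ω : StrongDual ℂ (Elt M), ψ ∈ predual M →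
      Tendsto (fun n => ψ.comp (s n)) atTop (𝓝 ω) := fun ψ => by
    by_cases hψ : ψ ∈ predual M
    · obtain ⟨ω, hω⟩ := cauchySeq_tendsto_of_complete (hc ψ hψ)
      exact ⟨ω, fun _ => hω⟩
    -- An arbitrary value outside `M_*`.
    · exact ⟨0, fun h => absurd h hψ⟩
  choose Ω hΩ using hex
  have hΩx : ∀ x, ∀ ψ ∈ predual M, Tendsto (fun n => ψ (s n x)) atTop (𝓝 (Ω ψ x)) :=
    fun x ψ hψ => ((ContinuousLinearMap.apply ℂ ℂ x).continuous.tendsto _).comp (hΩ ψ hψ)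
  obtain ⟨E, hE, hEΩ⟩ := exists_clm_of_forall_predual (M := M) (fun x ψ => Ω ψ x)
    (fun x y ψ _ => map_add _ _ _) (fun c x ψ _ => map_smul _ _ _)
    (fun x ψ hψ ψ' hψ' => tendsto_nhds_unique (hΩx x _ ((predual M).add_mem hψ hψ'))
      ((hΩx x ψ hψ).add (hΩx x ψ' hψ')))
    (fun c x ψ hψ => tendsto_nhds_unique (hΩx x _ ((predual M).smul_mem c hψ))
      ((hΩx x ψ hψ).const_mul c))
    (fun x ψ hψ => le_of_tendsto (hΩx x ψ hψ).norm (Eventually.of_forall fun n => by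
      have h1 := (s n).le_of_opNorm_le (hs1 n) x
      rw [one_mul] at h1
      rw [mul_comm]
      exact (ψ.le_opNorm _).trans (mul_le_mul_of_nonneg_left h1 (norm_nonneg _))))
  have hcomp : ∀ ψ ∈ predual M, ψ.comp E = Ω ψ := fun ψ hψ => by
    ext x; exact hEΩ x ψ hψ
  refine ⟨E, hE, fun ψ hψ => ?_, fun ψ hψ => hcomp ψ hψ ▸ hΩ ψ hψ⟩
  rw [hcomp ψ hψ]
  exact isClosed_predual.mem_of_tendsto (hΩ ψ hψ) (Eventually.of_forall fun n => hsn n ψ hψ)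

end Limit

end VNErgodic

/-! ### The mean ergodic theorem -/

theorem theorem3p2
    {H : Type*} [NormedAddCommGroup H] [InnerProductSpace ℂ H] [CompleteSpace H]
    (M : VonNeumannAlgebra H)
    {G : Type*} [Group G] [TopologicalSpace G] [IsTopologicalGroup G] [T2Space G]
    [LocallyCompactSpace G] [SecondCountableTopology G] [MeasurableSpace G] [BorelSpace G]
    (m : Measure G) [m.IsHaarMeasure] (hG : VNErgodic.IsAmenable m)
    (F : ℕ → Set G) (hF : VNErgodic.IsFolnerSeq m F) (hT : VNErgodic.IsTempered m F)
    (α : G →* (VNErgodic.Elt M ≃⋆ₐ[ℂ] VNErgodic.Elt M))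
    (hα : ∀ x : VNErgodic.Elt M, ∀ ψ ∈ VNErgodic.predual M, AEMeasurable (fun g => ψ (α g x)) m)
    (φ : StrongDual ℂ (VNErgodic.Elt M)) (hφ : VNErgodic.IsFaithfulNormalState M φ)
    (hinv : ∀ g x, φ (α g x) = φ x) :
    ∃ s : ℕ → (VNErgodic.Elt M →L[ℂ] VNErgodic.Elt M),
      (∀ n, VNErgodic.IsAverage M α m (F n) (s n) ∧ s n 1 = 1 ∧
        VNErgodic.IsCompletelyPositive M (s n) ∧ VNErgodic.IsNormalMap M (s n)) ∧
      ∃ E : VNErgodic.Elt M →L[ℂ] VNErgodic.Elt M,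
        (VNErgodic.IsNormalNormOneProjection M (VNErgodic.fixedPoints M α) E ∧ φ.comp E = φ) ∧
        (∀ E' : VNErgodic.Elt M →L[ℂ] VNErgodic.Elt M,
          VNErgodic.IsNormalNormOneProjection M (VNErgodic.fixedPoints M α) E' →
          φ.comp E' = φ → E' = E) ∧
        ∀ ψ ∈ VNErgodic.predual M,
          Tendsto (fun n => ‖ψ.comp (s n) - ψ.comp E‖) atTop (𝓝 0) := by
  -- Inversion need not preserve Haar measure, but it preserves null sets, which is enough for
  -- measurability.
  have hα' : ∀ x : VNErgodic.Elt M, ∀ ψ ∈ VNErgodic.predual M,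
      AEMeasurable (fun g => ψ (α g⁻¹ x)) m := fun x ψ hψ =>
    (hα x ψ hψ).comp_quasiMeasurePreserving (quasiMeasurePreserving_inv m)
  have hFt : ∀ n, m (F n) ≠ ⊤ := fun n => (hF.isCompact n).measure_ne_top
  have hpos := hT.measureReal_pos hF.isCompact
  choose s hs1 hs using fun n => VNErgodic.exists_isWeakAverage (hFt n)
    (fun g => VNErgodic.autCLM (α g)) (fun g => VNErgodic.norm_autCLM_le _) hα
  choose S _ hS using fun n => VNErgodic.exists_isWeakAverage (hFt n)
    (fun g => VNErgodic.autCLM (α g⁻¹)) (fun g => VNErgodic.norm_autCLM_le _) hα'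
  have hsn := fun n => VNErgodic.isNormalMap_average hφ hinv (hs n) (hS n)
  have hsfix : ∀ n, ∀ x ∈ VNErgodic.fixedPoints M α, s n x = x := fun n x hx =>
    (hs n).apply_eq (hpos n) hx
  have hsone : ∀ n, s n 1 = 1 := fun n => hsfix n 1 (VNErgodic.fixedPoints M α).one_mem
  have hsφ : ∀ n, φ.comp (s n) = φ := fun n => by
    ext x
    refine ((hs n) x φ hφ.normal).2.trans ?_
    simp only [VNErgodic.autCLM_apply, hinv, setIntegral_const]
    exact inv_smul_smul₀ (hpos n).ne' _
  obtain ⟨E, hE1, hEn, hE⟩ := VNErgodic.exists_normal_limit hs1 hsn fun ψ hψ =>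
    VNErgodic.cauchySeq_comp_average hF hpos hα' hφ hinv hs1 hs hS hψ
  have hEx : ∀ x, ∀ ψ ∈ VNErgodic.predual M, Tendsto (fun n => ψ (s n x)) atTop (𝓝 (ψ (E x))) :=
    fun x ψ hψ => ((ContinuousLinearMap.apply ℂ ℂ x).continuous.tendsto _).comp (hE ψ hψ)
  have hEfix : ∀ x ∈ VNErgodic.fixedPoints M α, E x = x := fun x hx =>
    VNErgodic.eq_of_forall_predual fun ψ hψ => by
      refine tendsto_nhds_unique (hEx x ψ hψ) ?_
      simp only [hsfix _ x hx]
      exact tendsto_const_nhds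
  -- By normality of `α k`, `ψ(α k (s_n x))` tends to `ψ(α k (E x))`; by the Følner property it has
  -- the same limit as `ψ(s_n x)`.
  have hEmem : ∀ x, E x ∈ VNErgodic.fixedPoints M α := fun x k =>
    VNErgodic.eq_of_forall_predual fun ψ hψ => by
      have h1 := hEx x _ (VNErgodic.isNormalMap_autCLM hφ hinv k ψ hψ)
      have h2 : Tendsto (fun n => ψ (α k (s n x) - s n x)) atTop (𝓝 0) := by
        have h3 := (VNErgodic.tendsto_norm_apply_average_sub hF hα hφ hinv hs k x).const_mul ‖ψ‖
        rw [mul_zero] at h3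
        exact squeeze_zero_norm (fun n => ψ.le_opNorm _) h3
      have h4 := h2.add (hEx x ψ hψ)
      simp only [← map_add, sub_add_cancel, zero_add] at h4
      exact tendsto_nhds_unique h1 h4
  have hEone : E 1 = 1 := hEfix 1 (VNErgodic.fixedPoints M α).one_mem
  have hEproj : VNErgodic.IsNormalNormOneProjection M (VNErgodic.fixedPoints M α) E := by
    refine ⟨hEn, le_antisymm hE1 ?_, hEmem, hEfix⟩
    have hne : Nontrivial (VNErgodic.Elt M) :=
      ⟨⟨1, 0, fun h => by simpa [h] using hφ.map_one⟩⟩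
    have := E.le_opNorm 1
    rwa [hEone, CStarRing.norm_one, mul_one] at this
  have hEφ : φ.comp E = φ := by
    refine tendsto_nhds_unique (hE φ hφ.normal) ?_
    simp only [hsφ]
    exact tendsto_const_nhds
  exact ⟨s, fun n => ⟨hs n, hsone n, VNErgodic.isCompletelyPositive_average (hs n), hsn n⟩,
    E, ⟨hEproj, hEφ⟩, fun E' hE' hφE' => hEproj.eq_of_invariant hφ hEφ hE' hφE',
    fun ψ hψ => tendsto_iff_norm_sub_tendsto_zero.1 (hE ψ hψ)⟩
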